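/- **Proposition (Isomorphism type).** Let $n \ge 2$ and $0 \le d \le n/2$. Let $v_1, \dots, v_n \in \mathbb{R}^{n-1}$ be unit vectors pointing to the vertices of an equilateral simplex with barycenter at the origin, i.e. $\|v_i\| = 1$, all distances $\|v_i - v_j\|$ ($i \ne j$) are equal, and $\sum_i v_i = 0$. Let $$V_{\mathcal H}^{(d)} = \{ q \in \mathbb{R}[z_1, \dots, z_{n-1}] \text{ homogeneous of degree } d : \langle v_i, \partial\rangle^2 q = 0 \text{ for } i = 1, \dots, n \},$$ where $\langle v, \partial \rangle = \sum_k v_k\, \partial/\partial z_k$. Let $W^{(n-d,d)} \subseteq \mathbb{R}[x_1, \dots, x_n]$ be the Specht module, that is, the linear span, over all standard Young tableaux $T$ with rows of lengths $n-d$ and $d$, of the Specht polynomials $\prod_{C} \prod_{i<j,\ i,j \in C} (x_i - x_j)$, where $C$ runs over the columns of $T$. The symmetric group $S_n$ acts on $\mathbb{R}[x_1, \dots, x_n]$ by algebra automorphisms with $\pi \cdot x_i = x_{\pi(i)}$, and on $\mathbb{R}[z_1, \dots, z_{n-1}]$ by the unique algebra automorphisms with $\pi \cdot \langle v_i, z\rangle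 = \langle v_{\pi(i)}, z\rangle$ for all $i$. Let $\Psi : \mathbb{R}[x_1, \dots, x_n] \to \mathbb{R}[z_1, \dots, z_{n-1}]$ be the linear map sending $x^S = \prod_{i \in S} x_i$ to $\prod_{i \in S} \langle v_i, z\rangle$ for every multiset $S$ of elements of $\{1, \dots, n\}$. Then $W^{(n-d,d)}$ and $V_{\mathcal H}^{(d)}$ are invariant under these actions of $S_n$, and $\Psi$ restricts to an isomorphism $W^{(n-d,d)} \to V_{\mathcal H}^{(d)}$ of $S_n$-representations. In particular $V_{\mathcal H}^{(d)} \cong W^{(n-d,d)}$. -/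

import Mathlib

/-! ### Polynomials in `x₁, …, xₙ` and Specht modules -/

/-- The symmetric group acts on `ℝ[x₁, …, xₙ]` by permuting the variables, `π · x_i = x_{π i}`. -/
noncomputable def permRep (n : ℕ) :
    Representation ℝ (Equiv.Perm (Fin n)) (MvPolynomial (Fin n) ℝ) where
  toFun π := (MvPolynomial.rename (R := ℝ) π).toLinearMap
  map_one' := by
    refine LinearMap.ext fun p => ?_
    simp
  map_mul' π τ := by
    refine LinearMap.ext fun p => ?_
    simp [MvPolynomial.rename_rename]

/-- A standard Young tableau of shape `μ`: each of the numbers of `Fin n` is placed in exactly one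
box, and rows and columns are strictly increasing. A box is a pair (row, column). -/
structure StandardTableau (μ : YoungDiagram) (n : ℕ) where
  /-- The entry in a box. -/
  entry : {c : ℕ × ℕ // c ∈ μ.cells} ≃ Fin n
  /-- Rows increase from left to right. -/
  row_lt : ∀ a b, a.1.1 = b.1.1 → a.1.2 < b.1.2 → entry a < entry b
  /-- Columns increase from top to bottom. -/
  col_lt : ∀ a b, a.1.2 = b.1.2 → a.1.1 < b.1.1 → entry a < entry b

/-- The column of the tableau in which the number `i` stands. -/
def StandardTableau.colOf {μ : YoungDiagram} {n : ℕ} (T : StandardTableau μ n) (i : Fin n) : ℕ :=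
  (T.entry.symm i).1.2

/-- The Specht polynomial `∏_C ∏_{i, j ∈ C, i < j} (x_i - x_j)`, over the columns `C` of `T`: the
pairs `i < j` lying in a common column. -/
noncomputable def spechtPolynomial {μ : YoungDiagram} {n : ℕ} (T : StandardTableau μ n) :
    MvPolynomial (Fin n) ℝ :=
  ∏ p : Fin n × Fin n with p.1 < p.2 ∧ T.colOf p.1 = T.colOf p.2,
    (MvPolynomial.X p.1 - MvPolynomial.X p.2)

/-- The Specht module `W^μ`: the span of the Specht polynomials of all standard tableaux of
shape `μ`. -/
noncomputable def spechtModule (μ : YoungDiagram) (n : ℕ) :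
    Submodule ℝ (MvPolynomial (Fin n) ℝ) :=
  Submodule.span ℝ (Set.range fun T : StandardTableau μ n => spechtPolynomial T)

/-- The Young diagram with rows of lengths `n - d` and `d` (a single row if `d = 0`). -/
def twoRowDiagram (n d : ℕ) (h : 2 * d ≤ n) : YoungDiagram :=
  YoungDiagram.ofRowLens [n - d, d] (by
    have h' : d ≤ n - d := by omega
    simpa [List.sortedGE_iff_pairwise] using h')

/-! ### Simplex vectors -/

/-- Unit vectors `v₁, …, vₙ` in `ℝ^{n-1}` pointing to the vertices of an equilateral simplex with
barycenter at the origin. -/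
structure IsSimplex {n : ℕ} (v : Fin n → EuclideanSpace ℝ (Fin (n - 1))) : Prop where
  norm_eq : ∀ i, ‖v i‖ = 1
  dist_eq : ∀ i j k l, i ≠ j → k ≠ l → dist (v i) (v j) = dist (v k) (v l)
  sum_eq : ∑ i, v i = 0

/-- The linear form `⟨w, z⟩`. -/
noncomputable def linForm {m : ℕ} (w : EuclideanSpace ℝ (Fin m)) : MvPolynomial (Fin m) ℝ :=
  ∑ k, w k • MvPolynomial.X k

/-- The first-order differential operator `⟨w, ∂⟩`. -/
noncomputable def dirDeriv {m : ℕ} (w : EuclideanSpace ℝ (Fin m)) :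
    MvPolynomial (Fin m) ℝ →ₗ[ℝ] MvPolynomial (Fin m) ℝ :=
  ∑ k, w k • (MvPolynomial.pderiv (R := ℝ) k).toLinearMap

/-- The space of homogeneous polynomials `q` of degree `d` in `z₁, …, z_{n-1}` such that
`⟨v_i, ∂⟩² q = 0` for all `i`. -/
noncomputable def simplexHarmonic {n : ℕ} (v : Fin n → EuclideanSpace ℝ (Fin (n - 1))) (d : ℕ) :
    Submodule ℝ (MvPolynomial (Fin (n - 1)) ℝ) :=
  MvPolynomial.homogeneousSubmodule (Fin (n - 1)) ℝ d ⊓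
    ⨅ i, LinearMap.ker (dirDeriv (v i) ∘ₗ dirDeriv (v i))

/-- The substitution `x_i ↦ ⟨v_i, z⟩`, which sends a monomial `x^S` to `∏_{i ∈ S} ⟨v_i, z⟩`, where
`S` is any multiset. -/
noncomputable def simplexSubst {n : ℕ} (v : Fin n → EuclideanSpace ℝ (Fin (n - 1))) :
    MvPolynomial (Fin n) ℝ →ₐ[ℝ] MvPolynomial (Fin (n - 1)) ℝ :=
  MvPolynomial.aeval fun i => linForm (v i)

theorem simplexSubst_prod {n : ℕ} (v : Fin n → EuclideanSpace ℝ (Fin (n - 1)))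
    (S : Multiset (Fin n)) :
    simplexSubst v (S.map MvPolynomial.X).prod = (S.map fun i => linForm (v i)).prod := by
  rw [map_multiset_prod, Multiset.map_map]
  simp [simplexSubst, Function.comp_def]

/-! ### The action of the symmetric group on `ℝ[z₁, …, z_{n-1}]` -/

theorem IsSimplex.inner_eq {n : ℕ} {v : Fin n → EuclideanSpace ℝ (Fin (n - 1))}
    (hv : IsSimplex v) (i j : Fin n) :
    ((n : ℝ) - 1) * inner ℝ (v i) (v j) = if i = j then (n : ℝ) - 1 else -1 := by
  have hself : ∀ i, inner ℝ (v i) (v i) = (1 : ℝ) := fun i => by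
    rw [real_inner_self_eq_norm_sq, hv.norm_eq]; norm_num
  split_ifs with h
  · subst h; rw [hself, mul_one]
  · have hall : ∀ l, i ≠ l → inner ℝ (v i) (v l) = inner ℝ (v i) (v j) := by
      intro l hl
      have h1 := hv.dist_eq i l i j hl h
      have h2 := norm_sub_sq_real (v i) (v l)
      have h3 := norm_sub_sq_real (v i) (v j)
      rw [dist_eq_norm, dist_eq_norm] at h1
      simp only [hv.norm_eq, h1] at h2 h3
      linarith
    have h0 : ∑ l, inner ℝ (v i) (v l) = (0 : ℝ) := by
      rw [← inner_sum, hv.sum_eq, inner_zero_right]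
    rw [← Finset.add_sum_erase _ _ (Finset.mem_univ i), hself,
      Finset.sum_congr rfl (fun l hl => hall l (Finset.ne_of_mem_erase hl).symm),
      Finset.sum_const, Finset.card_erase_of_mem (Finset.mem_univ i), Finset.card_univ,
      Fintype.card_fin, nsmul_eq_mul,
      Nat.cast_sub (by have := i.pos; omega), Nat.cast_one] at h0
    linarith

theorem IsSimplex.frame {n : ℕ} {v : Fin n → EuclideanSpace ℝ (Fin (n - 1))}
    (hv : IsSimplex v) (k l : Fin (n - 1)) :
    ((n : ℝ) - 1) * ∑ i, v i k * v i l = if k = l then (n : ℝ) else 0 := by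
  have hn : 1 ≤ n := by have := k.pos; omega
  let V : Matrix (Fin n) (Fin (n - 1)) ℝ := Matrix.of fun i k => v i k
  let J : Matrix (Fin n) (Fin n) ℝ := Matrix.of fun _ _ => 1
  let m : ℝ := (n : ℝ) - 1
  have hG : m • (V * V.transpose) = (n : ℝ) • (1 : Matrix (Fin n) (Fin n) ℝ) - J := by
    ext i j
    have h := hv.inner_eq i j
    rw [PiLp.inner_apply] at h
    simp only [RCLike.inner_apply, conj_trivial] at h
    simp only [Matrix.smul_apply, Matrix.mul_apply, Matrix.transpose_apply, Matrix.sub_apply,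
      Matrix.one_apply, V, J, m, Matrix.of_apply, smul_eq_mul]
    rw [Finset.sum_congr rfl (fun x _ => mul_comm (v i x) (v j x)), h]
    split_ifs <;> ring
  have hJ : J * V = 0 := by
    ext i k
    have h := congrArg (fun w : EuclideanSpace ℝ (Fin (n - 1)) => w k) hv.sum_eq
    simpa [Matrix.mul_apply, J, V] using h
  let F := V.transpose * V
  let B := m • F - (n : ℝ) • (1 : Matrix (Fin (n - 1)) (Fin (n - 1)) ℝ)
  have hFF : m • (F * F) = (n : ℝ) • F := by
    have : m • (F * F) = V.transpose * (m • (V * V.transpose)) * V := by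
      simp only [F, Matrix.mul_smul, Matrix.smul_mul, Matrix.mul_assoc]
    rw [this, hG, Matrix.mul_sub, Matrix.sub_mul, Matrix.mul_assoc _ J V, hJ]
    simp [F]
  have hF : m • (F * B) = 0 := by
    simp only [B, Matrix.mul_sub, Matrix.mul_smul, Matrix.mul_one, smul_sub]
    rw [hFF, sub_self]
  have htr : F.trace = n := by
    simp only [F, Matrix.trace_mul_comm V.transpose V]
    have h1 : ∀ i, (V * V.transpose) i i = 1 := fun i => by
      have h := real_inner_self_eq_norm_sq (v i)
      rw [hv.norm_eq, PiLp.inner_apply] at h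
      simpa [Matrix.mul_apply, V, sq] using h
    simp [Matrix.trace, h1]
  have hBB : B * B = -((n : ℝ) • B) := by
    have : B * B = m • (F * B) - (n : ℝ) • B := by
      conv_lhs => lhs; unfold B
      rw [Matrix.sub_mul, Matrix.smul_mul, Matrix.smul_mul, Matrix.one_mul]
    rw [this, hF, zero_sub]
  have hBt : B.transpose = B := by simp [B, F]
  have hB : B = 0 := by
    rw [← Matrix.trace_conjTranspose_mul_self_eq_zero_iff, Matrix.conjTranspose_eq_transpose_of_trivial,
      hBt, hBB]
    simp only [B, Matrix.trace_neg, Matrix.trace_smul, Matrix.trace_sub, htr, Matrix.trace_one,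
      Fintype.card_fin, m, smul_eq_mul, Nat.cast_sub hn, Nat.cast_one]
    ring
  have h := congrFun (congrFun hB k) l
  simp only [B, F, Matrix.sub_apply, Matrix.smul_apply, Matrix.mul_apply, Matrix.transpose_apply,
    V, Matrix.of_apply, smul_eq_mul, Matrix.one_apply, Matrix.zero_apply, m] at h
  rw [sub_eq_zero.mp h]
  split_ifs <;> simp

/-- The algebra endomorphism of `ℝ[z₁, …, z_{n-1}]` induced by a permutation `π` of simplex vectors.
It is the one with `⟨v_i, z⟩ ↦ ⟨v_{π i}, z⟩` for all `i` (see `simplexAct_linForm` and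
`eq_simplexAct`); on a variable, it is given by expanding
`z_k = ((n - 1) / n) ∑ i, (v_i)_k ⟨v_i, z⟩`. -/
noncomputable def simplexAct {n : ℕ} (v : Fin n → EuclideanSpace ℝ (Fin (n - 1)))
    (π : Equiv.Perm (Fin n)) :
    MvPolynomial (Fin (n - 1)) ℝ →ₐ[ℝ] MvPolynomial (Fin (n - 1)) ℝ :=
  MvPolynomial.aeval fun k => ∑ i, (((n : ℝ) - 1) / n * v i k) • linForm (v (π i))

theorem IsSimplex.X_eq {n : ℕ} {v : Fin n → EuclideanSpace ℝ (Fin (n - 1))}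
    (hv : IsSimplex v) (k : Fin (n - 1)) :
    (MvPolynomial.X k : MvPolynomial (Fin (n - 1)) ℝ) =
      ∑ i, (((n : ℝ) - 1) / n * v i k) • linForm (v i) := by
  have hn : (n : ℝ) ≠ 0 := by have := k.pos; exact_mod_cast (by omega : n ≠ 0)
  simp only [linForm, Finset.smul_sum, smul_smul]
  rw [Finset.sum_comm]
  simp only [← Finset.sum_smul]
  have h : ∀ l, ∑ i, ((n : ℝ) - 1) / n * v i k * v i l = if k = l then 1 else 0 := fun l => by
    have h' : ∑ i, ((n : ℝ) - 1) / n * v i k * v i l =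
        (((n : ℝ) - 1) * ∑ i, v i k * v i l) / n := by
      rw [Finset.mul_sum, Finset.sum_div]
      exact Finset.sum_congr rfl fun i _ => by ring
    rw [h', hv.frame]
    split_ifs <;> simp [hn]
  simp [h]

theorem IsSimplex.simplexAct_linForm {n : ℕ} {v : Fin n → EuclideanSpace ℝ (Fin (n - 1))}
    (hv : IsSimplex v) (π : Equiv.Perm (Fin n)) (j : Fin n) :
    simplexAct v π (linForm (v j)) = linForm (v (π j)) := by
  have hn : (n : ℝ) ≠ 0 := by have := j.pos; exact_mod_cast (by omega : n ≠ 0)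
  have hsum : ∑ i, linForm (v (π i)) = 0 := by
    rw [Equiv.sum_comp π fun i => linForm (v i)]
    simp only [linForm]
    rw [Finset.sum_comm]
    simp only [← Finset.sum_smul]
    refine Finset.sum_eq_zero fun k _ => ?_
    have h := congrArg (fun w : EuclideanSpace ℝ (Fin (n - 1)) => w k) hv.sum_eq
    simp only [WithLp.ofLp_sum, Finset.sum_apply, WithLp.ofLp_zero, Pi.zero_apply] at h
    rw [h, zero_smul]
  have hexp : simplexAct v π (linForm (v j)) =
      ∑ i, ((1 / (n : ℝ)) * (((n : ℝ) - 1) * inner ℝ (v i) (v j))) • linForm (v (π i)) := by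
    conv_lhs => rw [linForm]
    simp only [map_sum, map_smul, simplexAct, MvPolynomial.aeval_X, Finset.smul_sum, smul_smul]
    rw [Finset.sum_comm]
    refine Finset.sum_congr rfl fun i _ => ?_
    rw [← Finset.sum_smul, PiLp.inner_apply, Finset.mul_sum, Finset.mul_sum]
    congr 1
    refine Finset.sum_congr rfl fun k _ => ?_
    simp only [RCLike.inner_apply, conj_trivial]
    ring
  have hcoef : ∀ i, (1 / (n : ℝ)) * (((n : ℝ) - 1) * inner ℝ (v i) (v j)) =
      (if i = j then 1 else 0) - 1 / (n : ℝ) := fun i => by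
    rw [hv.inner_eq]
    split_ifs
    · field_simp
    · ring
  rw [hexp]
  simp only [hcoef, sub_smul, Finset.sum_sub_distrib, ← Finset.smul_sum, hsum, smul_zero, sub_zero]
  simp

theorem IsSimplex.eq_simplexAct {n : ℕ} {v : Fin n → EuclideanSpace ℝ (Fin (n - 1))}
    (hv : IsSimplex v) (π : Equiv.Perm (Fin n))
    (f : MvPolynomial (Fin (n - 1)) ℝ →ₐ[ℝ] MvPolynomial (Fin (n - 1)) ℝ)
    (hf : ∀ i, f (linForm (v i)) = linForm (v (π i))) : f = simplexAct v π := by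
  refine MvPolynomial.algHom_ext fun k => ?_
  rw [hv.X_eq k]
  simp only [map_sum, map_smul, hf, hv.simplexAct_linForm]

/-- The symmetric group acts on `ℝ[z₁, …, z_{n-1}]` by algebra automorphisms that permute the linear
forms `⟨v_i, z⟩`, that is, `π · ⟨v_i, z⟩ = ⟨v_{π i}, z⟩`. -/
noncomputable def simplexRep {n : ℕ} (v : Fin n → EuclideanSpace ℝ (Fin (n - 1)))
    (hv : IsSimplex v) :
    Representation ℝ (Equiv.Perm (Fin n)) (MvPolynomial (Fin (n - 1)) ℝ) where
  toFun π := (simplexAct v π).toLinearMap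
  map_one' := by
    rw [← hv.eq_simplexAct 1 (AlgHom.id ℝ _) fun i => by simp]
    rfl
  map_mul' π τ := by
    rw [← hv.eq_simplexAct (π * τ) ((simplexAct v π).comp (simplexAct v τ))
      fun i => by simp [hv.simplexAct_linForm]]
    rfl

/-!
Let `L : ℝⁿ → ℝ^{n-1}` be the surjection `y ↦ ∑ i, y_i v_i`, whose kernel is spanned by
`(1, …, 1)`. Pulling polynomials back along `L` (`simplexPullback`) is injective, and by the chain
rule it turns `⟨v_i, ∂⟩` into `∂_i`. So it embeds the space of `q` with `⟨v_i, ∂⟩² q = 0` into the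
space `H_d` of square-free forms of degree `d` (`∂_i² p = 0`) which are killed by
`D = ∑ i, ∂_i`, the derivative in the direction of `(1, …, 1)` (`shiftDeriv`).

Composed with `Ψ` (`simplexSubst`), the pullback is multiplication by `c = n / (n - 1)` on linear
forms in `z`, and multiplies every difference `x_i - x_j` by `c`, because
`⟨v_i, L y⟩ = c y_i - (∑ j, y_j) / (n - 1)`. Specht polynomials of two-row shape are products of `d`
differences, so on the Specht module and on `V_H^(d)` the two composites are multiplication by
`c^d`. The isomorphism follows once the Specht module is known to be all of `H_d`
(`mem_spechtModule_twoRow_iff`). Invariance of the Specht module is then immediate, and invariance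
of `V_H^(d)` follows from the equivariance of `Ψ`.

That Specht polynomials lie in `H_d` is a direct computation. That they span `H_d`
(`IsSquarefreeForm.mem_span_columnProducts`) is proved by induction on the number of variables.
Write `p = g + x_n h`. Then `h = ∂_n p` is a form of the same kind of degree `d - 1` in one variable
less, hence a combination of Specht polynomials, and appending the number `n` to the second row of the
tableaux lifts this combination to one with the same `∂_n` as `p`. The difference does not involve
`x_n`; it is treated by induction again, unless `2 d > n - 1`, where it vanishes because `D` is
injective above the middle degree (`IsSquarefreeForm.eq_zero_of_shiftDeriv_iterate_eq_zero`).
-/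

/-! ### The derivation generating simultaneous translations -/

open MvPolynomial in
/-- The derivation `∑ i, ∂/∂x_i`, the infinitesimal generator of the simultaneous translations
`x_i ↦ x_i + t`. -/
noncomputable def shiftDeriv (N : ℕ) :
    Derivation ℝ (MvPolynomial (Fin N) ℝ) (MvPolynomial (Fin N) ℝ) :=
  mkDerivation ℝ fun _ => 1

open MvPolynomial in
theorem shiftDeriv_X {N : ℕ} (i : Fin N) : shiftDeriv N (X i) = 1 := by
  simp [shiftDeriv]

open MvPolynomial in
theorem shiftDeriv_eq_sum {N : ℕ} (p : MvPolynomial (Fin N) ℝ) :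
    shiftDeriv N p = ∑ i, pderiv i p := by
  have hsum : ∀ q : MvPolynomial (Fin N) ℝ,
      (∑ i, pderiv i : Derivation ℝ (MvPolynomial (Fin N) ℝ) (MvPolynomial (Fin N) ℝ)) q =
        ∑ i, pderiv i q := fun q => by
    have := congrFun (map_sum Derivation.coeFnAddMonoidHom
      (fun i : Fin N => pderiv (R := ℝ) i) Finset.univ) q
    rwa [Finset.sum_apply] at this
  have h : shiftDeriv N = ∑ i, pderiv i := by
    refine MvPolynomial.derivation_ext fun j => ?_
    rw [shiftDeriv_X, hsum]
    simp [Pi.single_apply]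
  rw [h, hsum]

open MvPolynomial in
theorem pderiv_pderiv_comm {N : ℕ} (i j : Fin N) (p : MvPolynomial (Fin N) ℝ) :
    pderiv i (pderiv j p) = pderiv j (pderiv i p) := by
  have h : ⁅pderiv (R := ℝ) i, pderiv (R := ℝ) j⁆ = 0 := by
    refine MvPolynomial.derivation_ext fun k => ?_
    rw [Derivation.commutator_apply]
    by_cases hi : k = i <;> by_cases hj : k = j <;> simp [Pi.single_apply, hi, hj] <;>
      split_ifs <;> simp
  have h' := congrArg (fun D => D p) h
  simpa [Derivation.commutator_apply, sub_eq_zero] using h'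

open MvPolynomial in
theorem pderiv_shiftDeriv {N : ℕ} (i : Fin N) (p : MvPolynomial (Fin N) ℝ) :
    pderiv i (shiftDeriv N p) = shiftDeriv N (pderiv i p) := by
  simp only [shiftDeriv_eq_sum, map_sum, pderiv_pderiv_comm i]

open MvPolynomial in
theorem pderiv_shiftDeriv_iterate {N : ℕ} (i : Fin N) (j : ℕ) (p : MvPolynomial (Fin N) ℝ) :
    pderiv i ((shiftDeriv N)^[j] p) = (shiftDeriv N)^[j] (pderiv i p) := by
  induction j with
  | zero => rfl
  | succ j ih =>
    rw [Function.iterate_succ_apply', Function.iterate_succ_apply', pderiv_shiftDeriv, ih]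

theorem shiftDeriv_iterate_zero (N j : ℕ) : (shiftDeriv N)^[j] 0 = 0 :=
  Function.iterate_fixed (map_zero _) j

open MvPolynomial in
theorem shiftDeriv_iterate_sub {N : ℕ} (j : ℕ) (p q : MvPolynomial (Fin N) ℝ) :
    (shiftDeriv N)^[j] (p - q) = (shiftDeriv N)^[j] p - (shiftDeriv N)^[j] q := by
  induction j with
  | zero => rfl
  | succ j ih => simp only [Function.iterate_succ_apply', ih, map_sub]

open MvPolynomial in
/-- Leibniz' rule for `D^j (x_i h)`, where `D = shiftDeriv N` and `D x_i = 1`. -/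
theorem shiftDeriv_iterate_X_mul {N : ℕ} (i : Fin N) (j : ℕ) (h : MvPolynomial (Fin N) ℝ) :
    (shiftDeriv N)^[j + 1] (X i * h) =
      X i * (shiftDeriv N)^[j + 1] h + (j + 1) • (shiftDeriv N)^[j] h := by
  induction j with
  | zero =>
    simp [Derivation.leibniz, shiftDeriv_X]
  | succ j ih =>
    rw [Function.iterate_succ_apply', ih, map_add, Derivation.leibniz, shiftDeriv_X, map_nsmul,
      ← Function.iterate_succ_apply' (f := shiftDeriv N),
      ← Function.iterate_succ_apply' (f := shiftDeriv N)]
    simp only [smul_eq_mul, nsmul_eq_mul]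
    push_cast
    ring

/-! ### Square-free forms -/

open MvPolynomial in
/-- Homogeneous polynomials of degree `d` in the variables `x_i`, `i < n`, of degree at most one in
each variable. Both conditions on the variables are expressed by partial derivatives: `∂_i² p = 0`,
and `∂_i p = 0` for `i ≥ n`. -/
structure IsSquarefreeForm {N : ℕ} (n d : ℕ) (p : MvPolynomial (Fin N) ℝ) : Prop where
  isHomogeneous : p.IsHomogeneous d
  pderiv_pderiv : ∀ i, pderiv i (pderiv i p) = 0
  pderiv_of_le : ∀ i : Fin N, n ≤ i → pderiv i p = 0

namespace IsSquarefreeForm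

open MvPolynomial

variable {N n d : ℕ} {p q : MvPolynomial (Fin N) ℝ}

theorem add (hp : IsSquarefreeForm n d p) (hq : IsSquarefreeForm n d q) :
    IsSquarefreeForm n d (p + q) where
  isHomogeneous := hp.isHomogeneous.add hq.isHomogeneous
  pderiv_pderiv i := by rw [map_add, map_add, hp.pderiv_pderiv, hq.pderiv_pderiv, add_zero]
  pderiv_of_le i hi := by rw [map_add, hp.pderiv_of_le i hi, hq.pderiv_of_le i hi, add_zero]

theorem smul (c : ℝ) (hp : IsSquarefreeForm n d p) : IsSquarefreeForm n d (c • p) where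
  isHomogeneous := (homogeneousSubmodule (Fin N) ℝ d).smul_mem c hp.isHomogeneous
  pderiv_pderiv i := by rw [Derivation.map_smul, Derivation.map_smul, hp.pderiv_pderiv, smul_zero]
  pderiv_of_le i hi := by rw [Derivation.map_smul, hp.pderiv_of_le i hi, smul_zero]

theorem sub (hp : IsSquarefreeForm n d p) (hq : IsSquarefreeForm n d q) :
    IsSquarefreeForm n d (p - q) := by
  simpa [sub_eq_add_neg] using hp.add (hq.smul (-1))

protected theorem zero : IsSquarefreeForm n d (0 : MvPolynomial (Fin N) ℝ) where
  isHomogeneous := isHomogeneous_zero _ _ _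
  pderiv_pderiv i := by simp
  pderiv_of_le i _ := by simp

/-- If the last variable does not occur, it can be dropped. -/
theorem of_pderiv_eq_zero {hn : n < N} (hp : IsSquarefreeForm (n + 1) d p)
    (h : pderiv ⟨n, hn⟩ p = 0) : IsSquarefreeForm n d p where
  isHomogeneous := hp.isHomogeneous
  pderiv_pderiv := hp.pderiv_pderiv
  pderiv_of_le i hi := by
    rcases hi.eq_or_lt with h' | h'
    · rwa [show i = ⟨n, hn⟩ from Fin.ext h'.symm]
    · exact hp.pderiv_of_le i h'

theorem pderiv_last (hn : n < N) (hp : IsSquarefreeForm (n + 1) d p) :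
    IsSquarefreeForm n (d - 1) (pderiv ⟨n, hn⟩ p) :=
  of_pderiv_eq_zero (hn := hn)
    { isHomogeneous := hp.isHomogeneous.pderiv
      pderiv_pderiv := fun i => by
        rw [pderiv_pderiv_comm i ⟨n, hn⟩, pderiv_pderiv_comm i ⟨n, hn⟩, hp.pderiv_pderiv, map_zero]
      pderiv_of_le := fun i hi => by rw [pderiv_pderiv_comm i, hp.pderiv_of_le i hi, map_zero] }
    (hp.pderiv_pderiv _)

/-- The part `g` of a square-free form `p = g + x_n h` which does not involve the last variable. -/
theorem sub_X_mul_pderiv (hn : n < N) (hd : 1 ≤ d) (hp : IsSquarefreeForm (n + 1) d p) :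
    IsSquarefreeForm n d (p - X ⟨n, hn⟩ * pderiv ⟨n, hn⟩ p) := by
  have hq := hp.pderiv_last hn
  refine of_pderiv_eq_zero (hn := hn) (hp.sub ⟨?_, fun i => ?_, fun i hi => ?_⟩) ?_
  · have := (isHomogeneous_X ℝ (⟨n, hn⟩ : Fin N)).mul hq.isHomogeneous
    rwa [Nat.add_sub_cancel' hd] at this
  · by_cases h : i = ⟨n, hn⟩
    · subst h
      simp [hp.pderiv_pderiv]
    · simp [pderiv_X_of_ne (Ne.symm h), hq.pderiv_pderiv]
  · have h : (⟨n, hn⟩ : Fin N) ≠ i := by rintro rfl; simp at hi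
    simp [pderiv_X_of_ne h, hq.pderiv_of_le i (by omega)]
  · simp [hp.pderiv_pderiv]

/-- `D^j` is injective on square-free forms of degree `d` in `n` variables when `n + j ≤ 2 d`:
the lowering operator of the Boolean lattice is injective above the middle rank, even when iterated
down to the complementary rank `n - d`. Allowing all `j` is what makes induction on `n`
work: writing `p = g + x_n h`, one gets `D^(j+1) g = 0` and then `D^(j-1) h = 0`. -/
theorem eq_zero_of_shiftDeriv_iterate_eq_zero (hnN : n ≤ N) {j : ℕ}
    (hp : IsSquarefreeForm n d p) (h : (shiftDeriv N)^[j] p = 0) (hj : n + j ≤ 2 * d) : p = 0 := by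
  induction n generalizing d j p with
  | zero =>
    rcases Nat.eq_zero_or_pos d with rfl | hd
    · obtain rfl : j = 0 := by omega
      exact h
    · -- all partial derivatives vanish, so Euler's identity gives `d • p = 0`
      have := hp.isHomogeneous.sum_X_mul_pderiv
      simp only [hp.pderiv_of_le _ (Nat.zero_le _), mul_zero, Finset.sum_const_zero] at this
      exact (smul_eq_zero.mp this.symm).resolve_left hd.ne'
  | succ n ih =>
    rcases j with _ | j
    · exact h
    have hn : n < N := hnN
    set q := pderiv ⟨n, hn⟩ p with hq
    have hDq : (shiftDeriv N)^[j + 1] q = 0 := by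
      rw [hq, ← pderiv_shiftDeriv_iterate, h, map_zero]
    have hDg : (shiftDeriv N)^[j + 1] (p - X ⟨n, hn⟩ * q) = -((j + 1) • (shiftDeriv N)^[j] q) := by
      rw [shiftDeriv_iterate_sub, shiftDeriv_iterate_X_mul, h, hDq]
      simp
    have hg : p - X ⟨n, hn⟩ * q = 0 := by
      refine ih hn.le (hp.sub_X_mul_pderiv hn (by omega)) (j := j + 2) ?_ (by omega)
      rw [Function.iterate_succ_apply', hDg, map_neg, map_nsmul,
        ← Function.iterate_succ_apply' (f := shiftDeriv N), hDq, smul_zero, neg_zero]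
    have hq0 : q = 0 := by
      refine ih hn.le (hp.pderiv_last hn) (j := j) ?_ (by omega)
      rw [hg, shiftDeriv_iterate_zero, eq_comm, neg_eq_zero] at hDg
      exact (smul_eq_zero.mp hDg).resolve_left (Nat.succ_ne_zero j)
    rwa [hq0, mul_zero, sub_zero] at hg

end IsSquarefreeForm

/-! ### Two-row fillings and their column products -/

/-- The standard fillings of the two-row shape `(n - d, d)` by the first `n` elements of `Fin N`.
The rows are given by sequences `r₁` and `r₂`, of which only the first `n - d` and `d` terms
matter; keeping them as sequences makes it easy to append an entry. -/
structure IsTwoRowFilling {N : ℕ} (n d : ℕ) (r₁ r₂ : ℕ → Fin N) : Prop where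
  two_mul_le : 2 * d ≤ n
  row₁_lt : ∀ a b, a < b → b < n - d → r₁ a < r₁ b
  row₂_lt : ∀ a b, a < b → b < d → r₂ a < r₂ b
  col_lt : ∀ c, c < d → r₁ c < r₂ c
  disjoint : ∀ a b, a < n - d → b < d → r₁ a ≠ r₂ b
  row₁_val_lt : ∀ a, a < n - d → (r₁ a : ℕ) < n
  row₂_val_lt : ∀ b, b < d → (r₂ b : ℕ) < n

open MvPolynomial in
/-- The product of the differences of the two entries in each of the first `d` columns. -/
noncomputable def columnProduct {N : ℕ} (d : ℕ) (r₁ r₂ : ℕ → Fin N) : MvPolynomial (Fin N) ℝ :=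
  ∏ c ∈ Finset.range d, (X (r₁ c) - X (r₂ c))

namespace IsTwoRowFilling

open MvPolynomial

variable {N n d : ℕ} {r₁ r₂ : ℕ → Fin N}

theorem row₁_ne (h : IsTwoRowFilling n d r₁ r₂) {a b : ℕ} (hab : a ≠ b) (ha : a < n - d)
    (hb : b < n - d) : r₁ a ≠ r₁ b := by
  rcases hab.lt_or_gt with hab | hab
  · exact (h.row₁_lt a b hab hb).ne
  · exact (h.row₁_lt b a hab ha).ne'

theorem row₂_ne (h : IsTwoRowFilling n d r₁ r₂) {a b : ℕ} (hab : a ≠ b) (ha : a < d)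
    (hb : b < d) : r₂ a ≠ r₂ b := by
  rcases hab.lt_or_gt with hab | hab
  · exact (h.row₂_lt a b hab hb).ne
  · exact (h.row₂_lt b a hab ha).ne'

/-- The largest number, placed at the end of the first row. -/
theorem snoc_row₁ (h : IsTwoRowFilling n d r₁ r₂) (hn : n < N) :
    IsTwoRowFilling (n + 1) d (Function.update r₁ (n - d) ⟨n, hn⟩) r₂ := by
  have h2 := h.two_mul_le
  have hlen : n + 1 - d = n - d + 1 := by omega
  refine ⟨by omega, fun a b hab hb => ?_, h.row₂_lt, fun c hc => ?_, fun a b ha hb => ?_,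
    fun a ha => ?_, fun b hb => (h.row₂_val_lt b hb).trans (Nat.lt_succ_self n)⟩
  · rw [Function.update_of_ne (by omega : a ≠ n - d)]
    by_cases hb' : b = n - d
    · subst hb'
      rw [Function.update_self]
      exact Fin.lt_def.mpr (h.row₁_val_lt a (by omega))
    · rw [Function.update_of_ne hb']
      exact h.row₁_lt a b hab (by omega)
  · rw [Function.update_of_ne (by omega : c ≠ n - d)]
    exact h.col_lt c hc
  · by_cases ha' : a = n - d
    · subst ha'
      rw [Function.update_self]
      exact fun he => (h.row₂_val_lt b hb).ne' (congrArg Fin.val he)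
    · rw [Function.update_of_ne ha']
      exact h.disjoint a b (by omega) hb
  · by_cases ha' : a = n - d
    · subst ha'
      simp
    · rw [Function.update_of_ne ha']
      exact (h.row₁_val_lt a (by omega)).trans (Nat.lt_succ_self n)

/-- The largest number, placed at the end of the second row. -/
theorem snoc_row₂ (h : IsTwoRowFilling n d r₁ r₂) (hn : n < N) (hd : 2 * (d + 1) ≤ n + 1) :
    IsTwoRowFilling (n + 1) (d + 1) r₁ (Function.update r₂ d ⟨n, hn⟩) := by
  have hlen : n + 1 - (d + 1) = n - d := by omega
  refine ⟨hd, hlen ▸ h.row₁_lt, fun a b hab hb => ?_, fun c hc => ?_, fun a b ha hb => ?_,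
    fun a ha => (h.row₁_val_lt a (by omega)).trans (Nat.lt_succ_self n), fun b hb => ?_⟩
  · rw [Function.update_of_ne (by omega : a ≠ d)]
    by_cases hb' : b = d
    · subst hb'
      rw [Function.update_self]
      exact Fin.lt_def.mpr (h.row₂_val_lt a (by omega))
    · rw [Function.update_of_ne hb']
      exact h.row₂_lt a b hab (by omega)
  · by_cases hc' : c = d
    · subst hc'
      rw [Function.update_self]
      exact Fin.lt_def.mpr (h.row₁_val_lt c (by omega))
    · rw [Function.update_of_ne hc']
      exact h.col_lt c (by omega)
  · by_cases hb' : b = d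
    · subst hb'
      rw [Function.update_self]
      exact fun he => (h.row₁_val_lt a (by omega)).ne (congrArg Fin.val he)
    · rw [Function.update_of_ne hb']
      exact h.disjoint a b (by omega) (by omega)
  · by_cases hb' : b = d
    · subst hb'
      simp
    · rw [Function.update_of_ne hb']
      exact (h.row₂_val_lt b (by omega)).trans (Nat.lt_succ_self n)

theorem pderiv_columnProduct_eq_zero {m : ℕ} {i : Fin N}
    (hi : ∀ c < m, r₁ c ≠ i ∧ r₂ c ≠ i) : pderiv i (columnProduct m r₁ r₂) = 0 := by
  induction m with
  | zero => simp [columnProduct]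
  | succ m ih =>
    obtain ⟨h1, h2⟩ := hi m (Nat.lt_succ_self m)
    rw [columnProduct, Finset.prod_range_succ, ← columnProduct, pderiv_mul,
      ih fun c hc => hi c (hc.trans (Nat.lt_succ_self m)), map_sub, pderiv_X_of_ne h1,
      pderiv_X_of_ne h2]
    simp

theorem pderiv_pderiv_columnProduct (h : IsTwoRowFilling n d r₁ r₂) (i : Fin N) :
    pderiv i (pderiv i (columnProduct d r₁ r₂)) = 0 := by
  have h2 := h.two_mul_le
  suffices H : ∀ m ≤ d, pderiv i (pderiv i (columnProduct m r₁ r₂)) = 0 from H d le_rfl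
  intro m hm
  induction m with
  | zero => simp [columnProduct]
  | succ m ih =>
    rw [columnProduct, Finset.prod_range_succ, ← columnProduct]
    -- the columns are disjoint, so `x_i` occurs in at most one of the two factors
    by_cases hi : r₁ m = i ∨ r₂ m = i
    · have h0 : pderiv i (columnProduct m r₁ r₂) = 0 := by
        refine pderiv_columnProduct_eq_zero fun c hc => ?_
        rcases hi with rfl | rfl
        · exact ⟨h.row₁_ne (by omega) (by omega) (by omega),
            (h.disjoint m c (by omega) (by omega)).symm⟩
        · exact ⟨h.disjoint c m (by omega) (by omega),
            h.row₂_ne (by omega) (by omega) (by omega)⟩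
      have h1 : pderiv i (pderiv i (X (r₁ m) - X (r₂ m) : MvPolynomial (Fin N) ℝ)) = 0 := by
        simp only [map_sub, pderiv_X, Pi.single_apply]
        split_ifs <;> simp
      simp only [pderiv_mul, h0, h1, map_add, map_zero, zero_mul, mul_zero, add_zero]
    · push Not at hi
      have h1 : pderiv i (X (r₁ m) - X (r₂ m) : MvPolynomial (Fin N) ℝ) = 0 := by
        rw [map_sub, pderiv_X_of_ne hi.1, pderiv_X_of_ne hi.2, sub_zero]
      simp only [pderiv_mul, h1, ih (by omega), zero_mul, mul_zero, add_zero]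

theorem isSquarefreeForm_columnProduct (h : IsTwoRowFilling n d r₁ r₂) :
    IsSquarefreeForm n d (columnProduct d r₁ r₂) where
  isHomogeneous := by
    have := IsHomogeneous.prod (Finset.range d)
      (fun c => (X (r₁ c) - X (r₂ c) : MvPolynomial (Fin N) ℝ)) (fun _ => 1)
      fun c _ => (isHomogeneous_X ℝ (r₁ c)).sub (isHomogeneous_X ℝ (r₂ c))
    simpa [columnProduct] using this
  pderiv_pderiv := h.pderiv_pderiv_columnProduct
  pderiv_of_le i hi := by
    have h2 := h.two_mul_le
    refine pderiv_columnProduct_eq_zero fun c hc => ⟨?_, ?_⟩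
    · rintro rfl
      exact absurd (h.row₁_val_lt c (by omega)) (by omega)
    · rintro rfl
      exact absurd (h.row₂_val_lt c hc) (by omega)

end IsTwoRowFilling

theorem shiftDeriv_columnProduct {N : ℕ} (d : ℕ) (r₁ r₂ : ℕ → Fin N) :
    shiftDeriv N (columnProduct d r₁ r₂) = 0 := by
  induction d with
  | zero => simp [columnProduct]
  | succ d ih =>
    rw [columnProduct, Finset.prod_range_succ, ← columnProduct, Derivation.leibniz, ih, map_sub,
      shiftDeriv_X, shiftDeriv_X]
    simp

/-- The column products of the standard fillings of shape `(n - d, d)`. -/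
def columnProducts (N n d : ℕ) : Set (MvPolynomial (Fin N) ℝ) :=
  {p | ∃ r₁ r₂ : ℕ → Fin N, IsTwoRowFilling n d r₁ r₂ ∧ p = columnProduct d r₁ r₂}

theorem isSquarefreeForm_of_mem_span_columnProducts {N n d : ℕ} {p : MvPolynomial (Fin N) ℝ}
    (hp : p ∈ Submodule.span ℝ (columnProducts N n d)) :
    IsSquarefreeForm n d p ∧ shiftDeriv N p = 0 := by
  induction hp using Submodule.span_induction with
  | mem p hp =>
    obtain ⟨r₁, r₂, h, rfl⟩ := hp
    exact ⟨h.isSquarefreeForm_columnProduct, shiftDeriv_columnProduct d r₁ r₂⟩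
  | zero => exact ⟨.zero, map_zero _⟩
  | add p q _ _ hp hq => exact ⟨hp.1.add hq.1, by rw [map_add, hp.2, hq.2, add_zero]⟩
  | smul c p _ hp => exact ⟨hp.1.smul c, by rw [Derivation.map_smul, hp.2, smul_zero]⟩

theorem columnProducts_subset_succ {N n d : ℕ} (hn : n < N) :
    columnProducts N n d ⊆ columnProducts N (n + 1) d := by
  rintro _ ⟨r₁, r₂, h, rfl⟩
  have h2 := h.two_mul_le
  refine ⟨_, _, h.snoc_row₁ hn, Finset.prod_congr rfl fun c hc => ?_⟩
  rw [Function.update_of_ne (by have := Finset.mem_range.mp hc; omega : c ≠ n - d)]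

open MvPolynomial in
/-- Appending the last number to the second row lifts every combination of column products along
`∂_n`. -/
theorem exists_pderiv_eq_of_mem_span_columnProducts {N n d : ℕ} (hn : n < N)
    (hd : 2 * (d + 1) ≤ n + 1) {q : MvPolynomial (Fin N) ℝ}
    (hq : q ∈ Submodule.span ℝ (columnProducts N n d)) :
    ∃ p ∈ Submodule.span ℝ (columnProducts N (n + 1) (d + 1)), pderiv ⟨n, hn⟩ p = q := by
  suffices H : Submodule.span ℝ (columnProducts N n d) ≤
      (Submodule.span ℝ (columnProducts N (n + 1) (d + 1))).map
        (pderiv (R := ℝ) (⟨n, hn⟩ : Fin N)).toLinearMap by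
    simpa using H hq
  rw [Submodule.span_le]
  rintro _ ⟨r₁, r₂, h, rfl⟩
  refine ⟨-columnProduct (d + 1) r₁ (Function.update r₂ d ⟨n, hn⟩),
    Submodule.neg_mem _ (Submodule.subset_span ⟨_, _, h.snoc_row₂ hn hd, rfl⟩), ?_⟩
  have h1 : ∏ c ∈ Finset.range d, (X (r₁ c) - X (Function.update r₂ d ⟨n, hn⟩ c)) =
      columnProduct d r₁ r₂ := Finset.prod_congr rfl fun c hc => by
    rw [Function.update_of_ne (Finset.mem_range.mp hc).ne]
  have h3 : r₁ d ≠ ⟨n, hn⟩ := fun he =>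
    (h.row₁_val_lt d (by omega)).ne (congrArg Fin.val he)
  rw [columnProduct, Finset.prod_range_succ, h1, Function.update_self]
  simp [h.isSquarefreeForm_columnProduct.pderiv_of_le ⟨n, hn⟩ le_rfl,
    pderiv_X_of_ne h3]

open MvPolynomial in
/-- The column products of standard fillings span the square-free forms killed by `D`. By induction
on the number `n` of variables: `∂_n p` is such a form in fewer variables and of lower degree; a
combination of column products with the same `∂_n` is subtracted from `p`, and the difference does
not involve the last variable. -/
theorem IsSquarefreeForm.mem_span_columnProducts {N n d : ℕ} (hN : 0 < N) (hnN : n ≤ N)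
    (hd : 2 * d ≤ n) {p : MvPolynomial (Fin N) ℝ} (hp : IsSquarefreeForm n d p)
    (hD : shiftDeriv N p = 0) : p ∈ Submodule.span ℝ (columnProducts N n d) := by
  induction n generalizing d p with
  | zero =>
    obtain rfl : d = 0 := by omega
    have hC := totalDegree_eq_zero_iff_eq_C.mp
      ((totalDegree_zero_iff_isHomogeneous (p := p)).mpr hp.isHomogeneous)
    have hmem : (1 : MvPolynomial (Fin N) ℝ) ∈ columnProducts N 0 0 :=
      ⟨fun _ => ⟨0, hN⟩, fun _ => ⟨0, hN⟩, by constructor <;> simp, by simp [columnProduct]⟩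
    rw [hC, ← mul_one (C _), ← smul_eq_C_mul]
    exact Submodule.smul_mem _ _ (Submodule.subset_span hmem)
  | succ n ih =>
    have hn : n < N := hnN
    have key : ∀ q : MvPolynomial (Fin N) ℝ, IsSquarefreeForm (n + 1) d q → shiftDeriv N q = 0 →
        pderiv ⟨n, hn⟩ q = 0 → q ∈ Submodule.span ℝ (columnProducts N (n + 1) d) := by
      intro q hq hDq hq0
      have hq' := hq.of_pderiv_eq_zero hq0
      by_cases h2 : 2 * d ≤ n
      · exact Submodule.span_mono (columnProducts_subset_succ hn) (ih hn.le h2 hq' hDq)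
      · rw [hq'.eq_zero_of_shiftDeriv_iterate_eq_zero hn.le (j := 1) hDq (by omega)]
        exact Submodule.zero_mem _
    rcases d with _ | d
    · refine key p hp hD ?_
      rw [totalDegree_eq_zero_iff_eq_C.mp
        ((totalDegree_zero_iff_isHomogeneous (p := p)).mpr hp.isHomogeneous), pderiv_C]
    · have hq := ih hn.le (by omega) (hp.pderiv_last hn)
        (by rw [← pderiv_shiftDeriv, hD, map_zero])
      obtain ⟨p', hp', hp'q⟩ := exists_pderiv_eq_of_mem_span_columnProducts hn hd hq
      have h' := isSquarefreeForm_of_mem_span_columnProducts hp'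
      rw [← sub_add_cancel p p']
      exact Submodule.add_mem _ (key _ (hp.sub h'.1) (by rw [map_sub, hD, h'.2, sub_zero])
        (by rw [map_sub, hp'q, sub_self])) hp'

/-! ### Standard tableaux of two-row shape -/

theorem mem_twoRowDiagram {n d : ℕ} {h : 2 * d ≤ n} {c : ℕ × ℕ} :
    c ∈ (twoRowDiagram n d h).cells ↔ c.1 = 0 ∧ c.2 < n - d ∨ c.1 = 1 ∧ c.2 < d := by
  obtain ⟨i, j⟩ := c
  rw [YoungDiagram.mem_cells, twoRowDiagram, YoungDiagram.mem_ofRowLens]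
  rcases i with _ | _ | i <;> simp

theorem card_twoRowDiagram {n d : ℕ} (h : 2 * d ≤ n) :
    (twoRowDiagram n d h).cells.card = n := by
  have hcells : (twoRowDiagram n d h).cells =
      {0} ×ˢ Finset.range (n - d) ∪ {1} ×ˢ Finset.range d := by
    ext c
    rw [mem_twoRowDiagram]
    simp only [Finset.mem_union, Finset.mem_product, Finset.mem_singleton, Finset.mem_range]
  rw [hcells, Finset.card_union_of_disjoint]
  · simp only [Finset.card_product, Finset.card_singleton, Finset.card_range]
    omega
  · rw [Finset.disjoint_left]
    intro c h1 h2
    simp only [Finset.mem_product, Finset.mem_singleton] at h1 h2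
    omega

namespace StandardTableau

variable {n d : ℕ} {hd : 2 * d ≤ n}

/-- The `i`-th row of a tableau as a sequence, with a junk value `z` beyond the end of the row. -/
def row {μ : YoungDiagram} (T : StandardTableau μ n) (z : Fin n) (i j : ℕ) : Fin n :=
  if h : (i, j) ∈ μ.cells then T.entry ⟨(i, j), h⟩ else z

theorem row_of_mem {μ : YoungDiagram} (T : StandardTableau μ n) (z : Fin n) {i j : ℕ}
    (h : (i, j) ∈ μ.cells) : T.row z i j = T.entry ⟨(i, j), h⟩ :=
  dif_pos h

theorem colOf_entry {μ : YoungDiagram} (T : StandardTableau μ n)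
    (c : {c : ℕ × ℕ // c ∈ μ.cells}) : T.colOf (T.entry c) = c.1.2 := by
  rw [colOf, Equiv.symm_apply_apply]

theorem isTwoRowFilling_row (T : StandardTableau (twoRowDiagram n d hd) n) (z : Fin n) :
    IsTwoRowFilling n d (T.row z 0) (T.row z 1) := by
  have h0 : ∀ {a}, a < n - d → (0, a) ∈ (twoRowDiagram n d hd).cells := fun h =>
    mem_twoRowDiagram.mpr (.inl ⟨rfl, h⟩)
  have h1 : ∀ {a}, a < d → (1, a) ∈ (twoRowDiagram n d hd).cells := fun h =>
    mem_twoRowDiagram.mpr (.inr ⟨rfl, h⟩)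
  refine ⟨hd, fun a b hab hb => ?_, fun a b hab hb => ?_, fun c hc => ?_, fun a b ha hb => ?_,
    fun a _ => Fin.is_lt _, fun b _ => Fin.is_lt _⟩
  · rw [row_of_mem T z (h0 (hab.trans hb)), row_of_mem T z (h0 hb)]
    exact T.row_lt _ _ rfl hab
  · rw [row_of_mem T z (h1 (hab.trans hb)), row_of_mem T z (h1 hb)]
    exact T.row_lt _ _ rfl hab
  · rw [row_of_mem T z (h0 (by omega)), row_of_mem T z (h1 hc)]
    exact T.col_lt _ _ rfl Nat.zero_lt_one
  · rw [row_of_mem T z (h0 ha), row_of_mem T z (h1 hb)]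
    intro he
    simpa using congrArg (fun c => c.1.1) (T.entry.injective he)

end StandardTableau

theorem spechtPolynomial_eq_columnProduct {n d : ℕ} {hd : 2 * d ≤ n}
    (T : StandardTableau (twoRowDiagram n d hd) n) {r₁ r₂ : ℕ → Fin n}
    (h₁ : ∀ a (h : (0, a) ∈ (twoRowDiagram n d hd).cells), r₁ a = T.entry ⟨(0, a), h⟩)
    (h₂ : ∀ a (h : (1, a) ∈ (twoRowDiagram n d hd).cells), r₂ a = T.entry ⟨(1, a), h⟩) :
    spechtPolynomial T = columnProduct d r₁ r₂ := by
  have h0 : ∀ {a}, a < n - d → (0, a) ∈ (twoRowDiagram n d hd).cells := fun h =>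
    mem_twoRowDiagram.mpr (.inl ⟨rfl, h⟩)
  have h1 : ∀ {a}, a < d → (1, a) ∈ (twoRowDiagram n d hd).cells := fun h =>
    mem_twoRowDiagram.mpr (.inr ⟨rfl, h⟩)
  symm
  refine Finset.prod_bij (fun c _ => (r₁ c, r₂ c)) (fun c hc => ?_) (fun c hc c' hc' he => ?_)
    (fun p hp => ?_) fun c hc => rfl
  · rw [Finset.mem_range] at hc
    rw [Finset.mem_filter]
    dsimp only
    rw [h₁ c (h0 (by omega)), h₂ c (h1 hc), T.colOf_entry, T.colOf_entry]
    exact ⟨Finset.mem_univ _, T.col_lt _ _ rfl Nat.zero_lt_one, rfl⟩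
  · rw [Finset.mem_range] at hc hc'
    have he' := (Prod.ext_iff.mp he).2
    dsimp only at he'
    rw [h₂ c (h1 hc), h₂ c' (h1 hc')] at he'
    exact congrArg (fun c => c.1.2) (T.entry.injective he')
  · -- a pair in a common column consists of its entry in row `0` and its entry in row `1`
    obtain ⟨i, j⟩ := p
    obtain ⟨⟨⟨a, b⟩, hi⟩, rfl⟩ := T.entry.surjective i
    obtain ⟨⟨⟨a', b'⟩, hj⟩, rfl⟩ := T.entry.surjective j
    rw [Finset.mem_filter] at hp
    obtain ⟨-, hlt, hcol⟩ := hp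
    dsimp only at hlt hcol
    rw [T.colOf_entry, T.colOf_entry] at hcol
    dsimp only at hcol
    subst hcol
    have ha : a < a' := by
      by_contra hle
      rcases (not_lt.mp hle).eq_or_lt with rfl | hlt'
      · exact lt_irrefl _ hlt
      · exact lt_asymm hlt (T.col_lt _ _ rfl hlt')
    have hi' := mem_twoRowDiagram.mp hi
    have hj' := mem_twoRowDiagram.mp hj
    dsimp only at hi' hj'
    obtain ⟨rfl, rfl, hb⟩ : a = 0 ∧ a' = 1 ∧ b < d := by omega
    exact ⟨b, Finset.mem_range.mpr hb, Prod.ext (h₁ b hi) (h₂ b hj)⟩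

/-- A standard filling by all of `Fin n` comes from a standard tableau. -/
theorem IsTwoRowFilling.exists_tableau {n d : ℕ} (hd : 2 * d ≤ n) {r₁ r₂ : ℕ → Fin n}
    (h : IsTwoRowFilling n d r₁ r₂) :
    ∃ T : StandardTableau (twoRowDiagram n d hd) n,
      spechtPolynomial T = columnProduct d r₁ r₂ := by
  let f : {c : ℕ × ℕ // c ∈ (twoRowDiagram n d hd).cells} → Fin n := fun c =>
    if c.1.1 = 0 then r₁ c.1.2 else r₂ c.1.2
  have hf : Function.Injective f := by
    rintro ⟨⟨a, b⟩, hc⟩ ⟨⟨a', b'⟩, hc'⟩ he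
    have h1 := mem_twoRowDiagram.mp hc
    have h2 := mem_twoRowDiagram.mp hc'
    dsimp only [f] at he h1 h2
    by_contra hne
    rcases h1 with ⟨rfl, h1⟩ | ⟨rfl, h1⟩ <;> rcases h2 with ⟨rfl, h2⟩ | ⟨rfl, h2⟩
    · exact h.row₁_ne (fun hb => hne (by subst hb; rfl)) h1 h2 (by simpa using he)
    · exact h.disjoint b b' h1 h2 (by simpa using he)
    · exact h.disjoint b' b h2 h1 (by simpa using he.symm)
    · exact h.row₂_ne (fun hb => hne (by subst hb; rfl)) h1 h2 (by simpa using he)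
  have hbij : Function.Bijective f :=
    (Fintype.bijective_iff_injective_and_card f).mpr
      ⟨hf, by rw [Fintype.card_coe, card_twoRowDiagram, Fintype.card_fin]⟩
  let T : StandardTableau (twoRowDiagram n d hd) n :=
    { entry := Equiv.ofBijective f hbij
      row_lt := by
        rintro ⟨⟨a, b⟩, hc⟩ ⟨⟨a', b'⟩, hc'⟩ hrow hlt
        have h2 := mem_twoRowDiagram.mp hc'
        dsimp only at hrow hlt h2
        subst hrow
        rcases h2 with ⟨rfl, h2⟩ | ⟨rfl, h2⟩
        · simpa [f] using h.row₁_lt b b' hlt h2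
        · simpa [f] using h.row₂_lt b b' hlt h2
      col_lt := by
        rintro ⟨⟨a, b⟩, hc⟩ ⟨⟨a', b'⟩, hc'⟩ hcol hlt
        have h1 := mem_twoRowDiagram.mp hc
        have h2 := mem_twoRowDiagram.mp hc'
        dsimp only at hcol hlt h1 h2
        subst hcol
        obtain ⟨rfl, rfl, hb⟩ : a = 0 ∧ a' = 1 ∧ b < d := by omega
        simpa [f] using h.col_lt b hb }
  refine ⟨T, spechtPolynomial_eq_columnProduct T (fun a ha => ?_) fun a ha => ?_⟩ <;>
    simp [T, f]

theorem spechtModule_twoRow_eq_span {n d : ℕ} (hn : 0 < n) (hd : 2 * d ≤ n) :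
    spechtModule (twoRowDiagram n d hd) n = Submodule.span ℝ (columnProducts n n d) := by
  rw [spechtModule]
  congr 1
  ext p
  constructor
  · rintro ⟨T, rfl⟩
    exact ⟨_, _, T.isTwoRowFilling_row ⟨0, hn⟩, spechtPolynomial_eq_columnProduct T
      (fun _ h => T.row_of_mem _ h) fun _ h => T.row_of_mem _ h⟩
  · rintro ⟨r₁, r₂, h, rfl⟩
    exact h.exists_tableau hd

/-- The Specht module of shape `(n - d, d)` consists of the square-free forms of degree `d` that are
killed by `∑ i, ∂/∂x_i`. -/
theorem mem_spechtModule_twoRow_iff {n d : ℕ} (hn : 0 < n) (hd : 2 * d ≤ n)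
    {p : MvPolynomial (Fin n) ℝ} :
    p ∈ spechtModule (twoRowDiagram n d hd) n ↔ IsSquarefreeForm n d p ∧ shiftDeriv n p = 0 := by
  rw [spechtModule_twoRow_eq_span hn]
  exact ⟨isSquarefreeForm_of_mem_span_columnProducts,
    fun h => h.1.mem_span_columnProducts hn le_rfl hd h.2⟩

/-! ### Invariance of the Specht module -/

/-- The description of the Specht module by differential equations is manifestly symmetric, while
standard tableaux are not permuted by the symmetric group. -/
theorem permRep_mem_spechtModule_twoRow {n d : ℕ} (hn : 0 < n) (hd : 2 * d ≤ n)
    (π : Equiv.Perm (Fin n)) {p : MvPolynomial (Fin n) ℝ}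
    (hp : p ∈ spechtModule (twoRowDiagram n d hd) n) :
    permRep n π p ∈ spechtModule (twoRowDiagram n d hd) n := by
  rw [mem_spechtModule_twoRow_iff hn] at hp ⊢
  obtain ⟨hp, hD⟩ := hp
  have hpd : ∀ i (q : MvPolynomial (Fin n) ℝ), MvPolynomial.pderiv i (permRep n π q) =
      permRep n π (MvPolynomial.pderiv (π.symm i) q) := fun i q => by
    have := MvPolynomial.pderiv_rename π.injective (π.symm i) q
    rwa [Equiv.apply_symm_apply] at this
  refine ⟨⟨hp.isHomogeneous.rename_isHomogeneous, fun i => ?_,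
    fun i hi => absurd i.is_lt hi.not_gt⟩, ?_⟩
  · rw [hpd, hpd, hp.pderiv_pderiv, map_zero]
  · rw [shiftDeriv_eq_sum] at hD ⊢
    simp only [hpd]
    rw [← map_sum, Equiv.sum_comp π.symm fun i => MvPolynomial.pderiv i p, hD, map_zero]

/-! ### Pullback of polynomials along the simplex vectors -/

theorem mem_simplexHarmonic_iff {n d : ℕ} {v : Fin n → EuclideanSpace ℝ (Fin (n - 1))}
    {q : MvPolynomial (Fin (n - 1)) ℝ} :
    q ∈ simplexHarmonic v d ↔
      q.IsHomogeneous d ∧ ∀ i, dirDeriv (v i) (dirDeriv (v i) q) = 0 := by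
  simp [simplexHarmonic, MvPolynomial.mem_homogeneousSubmodule]

theorem dirDeriv_apply {m : ℕ} (w : EuclideanSpace ℝ (Fin m)) (q : MvPolynomial (Fin m) ℝ) :
    dirDeriv w q = ∑ k, w k • MvPolynomial.pderiv k q := by
  simp [dirDeriv]

theorem isHomogeneous_linForm {m : ℕ} (w : EuclideanSpace ℝ (Fin m)) :
    (linForm w).IsHomogeneous 1 :=
  MvPolynomial.IsHomogeneous.sum _ _ _ fun k _ =>
    (MvPolynomial.homogeneousSubmodule _ ℝ 1).smul_mem _ (MvPolynomial.isHomogeneous_X ℝ k)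

open MvPolynomial in
theorem MvPolynomial.IsHomogeneous.aeval_smul_X {σ : Type*} {d : ℕ} {p : MvPolynomial σ ℝ}
    (hp : p.IsHomogeneous d) (c : ℝ) :
    MvPolynomial.aeval (fun k => c • (X k : MvPolynomial σ ℝ)) p = c ^ d • p := by
  conv_lhs => rw [p.as_sum]
  conv_rhs => rw [p.as_sum]
  rw [map_sum, Finset.smul_sum]
  refine Finset.sum_congr rfl fun m hm => ?_
  have hm' : m.sum (fun _ e => e) = d := by
    have := hp (mem_support_iff.mp hm)
    simpa [Finsupp.weight_apply] using this
  rw [aeval_monomial, monomial_eq (a := coeff m p)]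
  simp only [smul_pow, Finsupp.prod, Finset.prod_smul, Finset.prod_pow_eq_pow_sum]
  rw [← hm', Finsupp.sum, mul_smul_comm]
  rfl

/-- The pullback of polynomials along the linear map `y ↦ ∑ i, y_i v_i` from `ℝⁿ` to `ℝ^{n-1}`. -/
noncomputable def simplexPullback {n : ℕ} (v : Fin n → EuclideanSpace ℝ (Fin (n - 1))) :
    MvPolynomial (Fin (n - 1)) ℝ →ₐ[ℝ] MvPolynomial (Fin n) ℝ :=
  MvPolynomial.aeval fun k => ∑ i, v i k • MvPolynomial.X i

section Pullback

open MvPolynomial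

variable {n d : ℕ} {v : Fin n → EuclideanSpace ℝ (Fin (n - 1))}

/-- The chain rule: `∂_i` of the pullback is the pullback of `⟨v_i, ∂⟩`. -/
theorem pderiv_simplexPullback (i : Fin n) (q : MvPolynomial (Fin (n - 1)) ℝ) :
    pderiv i (simplexPullback v q) = simplexPullback v (dirDeriv (v i) q) := by
  induction q using MvPolynomial.induction_on with
  | C a =>
    rw [← algebraMap_eq, AlgHom.commutes, algebraMap_eq, algebraMap_eq, pderiv_C, dirDeriv_apply]
    simp
  | add p q hp hq => simp only [map_add, hp, hq]
  | mul_X p k hp =>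
    have h1 : dirDeriv (v i) (p * X k) = dirDeriv (v i) p * X k + v i k • p := by
      simp only [dirDeriv_apply, pderiv_mul, smul_add, Finset.sum_add_distrib, Finset.sum_mul,
        smul_mul_assoc, pderiv_X]
      congr 1
      rw [Finset.sum_eq_single k]
      · simp
      · intro l _ hl
        simp [hl.symm]
      · simp
    have h2 : pderiv i (simplexPullback v (X k)) = C (v i k) := by
      simp only [simplexPullback, aeval_X, map_sum, Derivation.map_smul, pderiv_X]
      rw [Finset.sum_eq_single i]
      · simp [smul_eq_C_mul]
      · intro l _ hl
        simp [hl]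
      · simp
    rw [map_mul, pderiv_mul, hp, h1, h2, map_add, map_mul, map_smul, smul_eq_C_mul, mul_comm (C _)]

/-- A pullback is invariant under translation by `(1, …, 1)`, because `∑ i, v_i = 0`. -/
theorem IsSimplex.shiftDeriv_simplexPullback (hv : IsSimplex v)
    (q : MvPolynomial (Fin (n - 1)) ℝ) : shiftDeriv n (simplexPullback v q) = 0 := by
  have hsum : ∀ k, ∑ i, v i k = 0 := fun k => by
    simpa using congrArg (fun w : EuclideanSpace ℝ (Fin (n - 1)) => w k) hv.sum_eq
  simp only [shiftDeriv_eq_sum, pderiv_simplexPullback, ← map_sum, dirDeriv_apply]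
  rw [Finset.sum_comm]
  simp only [← Finset.sum_smul, hsum, zero_smul, Finset.sum_const_zero, map_zero]

theorem isHomogeneous_simplexPullback {q : MvPolynomial (Fin (n - 1)) ℝ} (hq : q.IsHomogeneous d) :
    (simplexPullback v q).IsHomogeneous d := by
  have := hq.aeval (fun k => ∑ i, v i k • (X i : MvPolynomial (Fin n) ℝ)) (n := 1) fun k =>
    IsHomogeneous.sum _ _ _ fun i _ =>
      (homogeneousSubmodule _ ℝ 1).smul_mem _ (isHomogeneous_X ℝ i)
  rwa [one_mul] at this

theorem isHomogeneous_simplexSubst {p : MvPolynomial (Fin n) ℝ} (hp : p.IsHomogeneous d) :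
    (simplexSubst v p).IsHomogeneous d := by
  have := hp.aeval (fun i => linForm (v i)) (n := 1) fun i => isHomogeneous_linForm (v i)
  rwa [one_mul] at this

theorem IsSimplex.simplexSubst_comp_simplexPullback (hn : 2 ≤ n) (hv : IsSimplex v) :
    (simplexSubst v).comp (simplexPullback v) =
      aeval fun k => ((n : ℝ) / (n - 1)) • (X k : MvPolynomial (Fin (n - 1)) ℝ) := by
  have hn' : (2 : ℝ) ≤ n := by exact_mod_cast hn
  have h1 : (n : ℝ) - 1 ≠ 0 := by linarith
  have h0 : (n : ℝ) ≠ 0 := by linarith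
  refine MvPolynomial.algHom_ext fun k => ?_
  conv_rhs => rw [aeval_X, hv.X_eq k, Finset.smul_sum]
  rw [AlgHom.comp_apply]
  simp only [simplexPullback, simplexSubst, aeval_X, map_sum, map_smul, smul_smul]
  refine Finset.sum_congr rfl fun i _ => ?_
  congr 1
  field_simp

theorem IsSimplex.simplexSubst_simplexPullback (hn : 2 ≤ n) (hv : IsSimplex v)
    {q : MvPolynomial (Fin (n - 1)) ℝ} (hq : q.IsHomogeneous d) :
    simplexSubst v (simplexPullback v q) = ((n : ℝ) / (n - 1)) ^ d • q := by
  rw [← hq.aeval_smul_X, ← hv.simplexSubst_comp_simplexPullback hn, AlgHom.comp_apply]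

theorem IsSimplex.simplexPullback_injective (hn : 2 ≤ n) (hv : IsSimplex v) :
    Function.Injective (simplexPullback v) := by
  have hn' : (2 : ℝ) ≤ n := by exact_mod_cast hn
  have h1 : (n : ℝ) - 1 ≠ 0 := by linarith
  have h0 : (n : ℝ) ≠ 0 := by linarith
  obtain ⟨f, hf⟩ : ∃ f : MvPolynomial (Fin (n - 1)) ℝ →ₐ[ℝ] MvPolynomial (Fin (n - 1)) ℝ,
      f.comp ((simplexSubst v).comp (simplexPullback v)) = AlgHom.id ℝ _ := by
    refine ⟨aeval fun k => (((n : ℝ) - 1) / n) • X k, MvPolynomial.algHom_ext fun k => ?_⟩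
    rw [hv.simplexSubst_comp_simplexPullback hn, AlgHom.comp_apply, aeval_X, map_smul, aeval_X,
      smul_smul, div_mul_div_comm, mul_comm (n : ℝ), div_self (mul_ne_zero h1 h0), one_smul,
      AlgHom.id_apply]
  intro q q' h
  have h' := congrArg (fun p => f (simplexSubst v p)) h
  have hf' : ∀ q, f (simplexSubst v (simplexPullback v q)) = q := fun q => by
    rw [← AlgHom.comp_apply, ← AlgHom.comp_apply, AlgHom.comp_assoc, hf, AlgHom.id_apply]
  simpa only [hf'] using h'

theorem simplexPullback_linForm (w : EuclideanSpace ℝ (Fin (n - 1))) :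
    simplexPullback v (linForm w) = ∑ j, (inner ℝ (v j) w : ℝ) • X j := by
  simp only [linForm, simplexPullback, map_sum, map_smul, aeval_X, Finset.smul_sum, smul_smul]
  rw [Finset.sum_comm]
  refine Finset.sum_congr rfl fun j _ => ?_
  rw [← Finset.sum_smul, PiLp.inner_apply]
  rfl

/-- Up to scaling, `x_i ↦ ∑ j, ⟨v_j, v_i⟩ x_j` is a translation, so it preserves differences. -/
theorem IsSimplex.simplexPullback_linForm_sub (hn : 2 ≤ n) (hv : IsSimplex v) (i j : Fin n) :
    simplexPullback v (linForm (v i) - linForm (v j)) =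
      ((n : ℝ) / (n - 1)) • (X i - X j : MvPolynomial (Fin n) ℝ) := by
  have hn' : (2 : ℝ) ≤ n := by exact_mod_cast hn
  have h1 : (n : ℝ) - 1 ≠ 0 := by linarith
  have hcoef : ∀ k l, (inner ℝ (v k) (v l) : ℝ) =
      ((n : ℝ) / (n - 1)) * (if k = l then 1 else 0) - 1 / (n - 1) := fun k l => by
    rw [eq_sub_iff_add_eq, ← mul_right_inj' h1, mul_add, hv.inner_eq]
    split_ifs <;> field_simp <;> ring
  have hlin : ∀ l, simplexPullback v (linForm (v l)) = ((n : ℝ) / (n - 1)) • X l -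
      ∑ k, (1 / ((n : ℝ) - 1)) • (X k : MvPolynomial (Fin n) ℝ) := fun l => by
    simp [simplexPullback_linForm, hcoef, sub_smul, Finset.sum_sub_distrib]
  rw [map_sub, hlin, hlin, smul_sub]
  abel

/-- Specht polynomials are products of `d` differences, each of which is only rescaled. -/
theorem IsSimplex.simplexPullback_simplexSubst (hn : 2 ≤ n) (hd : 2 * d ≤ n) (hv : IsSimplex v)
    {p : MvPolynomial (Fin n) ℝ} (hp : p ∈ spechtModule (twoRowDiagram n d hd) n) :
    simplexPullback v (simplexSubst v p) = ((n : ℝ) / (n - 1)) ^ d • p := by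
  rw [spechtModule_twoRow_eq_span (by omega)] at hp
  induction hp using Submodule.span_induction with
  | mem p hp =>
    obtain ⟨r₁, r₂, -, rfl⟩ := hp
    have hX : ∀ i, simplexSubst v (X i) = linForm (v i) := fun i => aeval_X _ i
    simp only [columnProduct, map_prod, map_sub (simplexSubst v), hX,
      hv.simplexPullback_linForm_sub hn, Finset.prod_smul, Finset.prod_const, Finset.card_range]
  | zero => simp
  | add p q _ _ hp hq => rw [map_add, map_add, hp, hq, smul_add]
  | smul c p _ hp => rw [map_smul, map_smul, hp, smul_comm]

/-! ### The isomorphism -/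

theorem IsSimplex.simplexSubst_mem (hn : 2 ≤ n) (hd : 2 * d ≤ n) (hv : IsSimplex v)
    {p : MvPolynomial (Fin n) ℝ} (hp : p ∈ spechtModule (twoRowDiagram n d hd) n) :
    simplexSubst v p ∈ simplexHarmonic v d := by
  have hp' := ((mem_spechtModule_twoRow_iff (by omega) hd).mp hp).1
  refine mem_simplexHarmonic_iff.mpr
    ⟨isHomogeneous_simplexSubst hp'.isHomogeneous, fun i => hv.simplexPullback_injective hn ?_⟩
  rw [← pderiv_simplexPullback, ← pderiv_simplexPullback,
    hv.simplexPullback_simplexSubst hn hd hp, Derivation.map_smul, Derivation.map_smul,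
    hp'.pderiv_pderiv, smul_zero, map_zero]

theorem IsSimplex.simplexPullback_mem (hn : 2 ≤ n) (hd : 2 * d ≤ n) (hv : IsSimplex v)
    {q : MvPolynomial (Fin (n - 1)) ℝ} (hq : q ∈ simplexHarmonic v d) :
    simplexPullback v q ∈ spechtModule (twoRowDiagram n d hd) n := by
  obtain ⟨hq, hq2⟩ := mem_simplexHarmonic_iff.mp hq
  refine (mem_spechtModule_twoRow_iff (by omega) hd).mpr
    ⟨⟨isHomogeneous_simplexPullback hq, fun i => ?_, fun i hi => absurd i.is_lt hi.not_gt⟩,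
      hv.shiftDeriv_simplexPullback q⟩
  rw [pderiv_simplexPullback, pderiv_simplexPullback, hq2, map_zero]

/-- Bijectivity: `simplexSubst` and `simplexPullback` are inverse to each other up to the scalar
`(n / (n - 1))^d`, in both directions. -/
theorem IsSimplex.simplexSubst_bijOn (hn : 2 ≤ n) (hd : 2 * d ≤ n) (hv : IsSimplex v) :
    Set.BijOn (simplexSubst v) (spechtModule (twoRowDiagram n d hd) n) (simplexHarmonic v d) := by
  have hn' : (2 : ℝ) ≤ n := by exact_mod_cast hn
  have hc : ((n : ℝ) / (n - 1)) ^ d ≠ 0 := pow_ne_zero _ (div_ne_zero (by linarith) (by linarith))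
  refine ⟨fun p hp => hv.simplexSubst_mem hn hd hp, fun p hp p' hp' h => ?_, fun q hq => ?_⟩
  · have h' := congrArg (simplexPullback v) h
    rw [hv.simplexPullback_simplexSubst hn hd hp, hv.simplexPullback_simplexSubst hn hd hp'] at h'
    exact smul_right_injective _ hc h'
  · refine ⟨(((n : ℝ) / (n - 1)) ^ d)⁻¹ • simplexPullback v q,
      Submodule.smul_mem _ _ (hv.simplexPullback_mem hn hd hq), ?_⟩
    rw [map_smul, hv.simplexSubst_simplexPullback hn (mem_simplexHarmonic_iff.mp hq).1, smul_smul,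
      inv_mul_cancel₀ hc, one_smul]

theorem IsSimplex.simplexSubst_permRep (hv : IsSimplex v) (π : Equiv.Perm (Fin n))
    (p : MvPolynomial (Fin n) ℝ) :
    simplexSubst v (permRep n π p) = simplexRep v hv π (simplexSubst v p) := by
  have h : (simplexSubst v).comp (rename π) = (simplexAct v π).comp (simplexSubst v) := by
    refine MvPolynomial.algHom_ext fun i => ?_
    simp [simplexSubst, hv.simplexAct_linForm]
  exact DFunLike.congr_fun h p

/-- Invariance is inherited from the Specht module along the equivariant surjection
`simplexSubst`. -/
theorem IsSimplex.simplexRep_mem_simplexHarmonic (hn : 2 ≤ n) (hd : 2 * d ≤ n) (hv : IsSimplex v)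
    (π : Equiv.Perm (Fin n)) {q : MvPolynomial (Fin (n - 1)) ℝ} (hq : q ∈ simplexHarmonic v d) :
    simplexRep v hv π q ∈ simplexHarmonic v d := by
  obtain ⟨p, hp, rfl⟩ := (hv.simplexSubst_bijOn hn hd).surjOn hq
  rw [← hv.simplexSubst_permRep]
  exact hv.simplexSubst_mem hn hd (permRep_mem_spechtModule_twoRow (by omega) hd π hp)

end Pullback

theorem mainTheorem3 (n d : ℕ) (hn : 2 ≤ n) (hd : 2 * d ≤ n)
    (v : Fin n → EuclideanSpace ℝ (Fin (n - 1))) (hv : IsSimplex v) :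
    ∃ (W : Subrepresentation (permRep n)) (V : Subrepresentation (simplexRep v hv)),
      W.toSubmodule = spechtModule (twoRowDiagram n d hd) n ∧
      V.toSubmodule = simplexHarmonic v d ∧
      ∃ e : W.toRepresentation.Equiv V.toRepresentation,
        ∀ p : W.toSubmodule, (e p : MvPolynomial (Fin (n - 1)) ℝ) =
          simplexSubst v (p : MvPolynomial (Fin n) ℝ) := by
  let W : Subrepresentation (permRep n) :=
    ⟨spechtModule (twoRowDiagram n d hd) n,
      fun π _ hp => permRep_mem_spechtModule_twoRow (by omega) hd π hp⟩
  let V : Subrepresentation (simplexRep v hv) :=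
    ⟨simplexHarmonic v d, fun π _ hq => hv.simplexRep_mem_simplexHarmonic hn hd π hq⟩
  have hbij := hv.simplexSubst_bijOn hn hd
  let e : W.toSubmodule ≃ₗ[ℝ] V.toSubmodule :=
    LinearEquiv.ofBijective
      ((simplexSubst v).toLinearMap.restrict (p := W.toSubmodule) (q := V.toSubmodule) hbij.mapsTo)
      hbij.bijective
  refine ⟨W, V, rfl, rfl, .mk e fun π => LinearMap.ext fun p => Subtype.ext ?_, fun p => rfl⟩
  exact hv.simplexSubst_permRep π p
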